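/- Let $\mathbb M_n$ be the space of $n\times n$ complex matrices, and for a positive semidefinite $X\in\mathbb M_d$ let $\lambda_1[X]\ge\dots\ge\lambda_d[X]$ be its eigenvalues, listed in decreasing order with multiplicities. A pair $(A,B)$ in $\mathbb M_n$ is a monotone pair if there are a positive semidefinite $C\in\mathbb M_n$ and non-negative, non-decreasing functions $f,g$ on $[0,\infty)$ with $A=f(C)$ and $B=g(C)$; a monotone pair $(A,B)$ is concave if in addition $A=h(B)$ for some concave function $h:[0,\infty)\to[0,\infty)$. Write $|Z|=(Z^*Z)^{1/2}$. For positive semidefinite $X,Y\in\mathbb M_d$, write $X\prec_{\mathrm{wlog}}Y$ if $$\prod_{j\le k}\lambda_j[X]\le\prod_{j\le k}\lambda_j[Y]\qquad\text{for all }k=1,\dots,d.$$ Corollary 2.5. Let $(A,B)$ be a concave monotone pair in $\mathbb M_n$ and let $\Phi:\mathbb M_n\to\mathbb M_d$ be a unital, positive linear map. Then $$|\Phi(A)\Phi(B)|\prec_{\mathrm{wlog}}\Phi(AB).$$ -/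

import Mathlib

open scoped MatrixOrder ComplexOrder

/-- `(A, B)` is a monotone pair in `M_n`: there are a positive `C` and two non-negative,
non-decreasing functions `f`, `g` on `[0, ∞)` with `A = f(C)` and `B = g(C)`. Every real function
is continuous on the (finite) spectrum of a matrix, so `cfc` is the usual functional calculus of
Hermitian matrices, for arbitrary `f`. -/
def IsMonotonePair {n : ℕ} (A B : Matrix (Fin n) (Fin n) ℂ) : Prop :=
  ∃ (C : Matrix (Fin n) (Fin n) ℂ) (f g : ℝ → ℝ), C.PosSemidef ∧
    MonotoneOn f (Set.Ici 0) ∧ (∀ t, 0 ≤ t → 0 ≤ f t) ∧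
    MonotoneOn g (Set.Ici 0) ∧ (∀ t, 0 ≤ t → 0 ≤ g t) ∧
    A = cfc f C ∧ B = cfc g C

/-- A monotone pair `(A, B)` is concave if `A = h(B)` for some concave
`h : [0, ∞) → [0, ∞)`. -/
def IsConcaveMonotonePair {n : ℕ} (A B : Matrix (Fin n) (Fin n) ℂ) : Prop :=
  IsMonotonePair A B ∧
    ∃ h : ℝ → ℝ, ConcaveOn ℝ (Set.Ici 0) h ∧ (∀ t, 0 ≤ t → 0 ≤ h t) ∧ A = cfc h B

/-- Weak log-majorization `X ≺_wlog Y` of positive semidefinite matrices: for every `1 ≤ k ≤ d`,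
the product of the `k` largest eigenvalues of `X` is at most that of `Y`. Here
`eigenvalues₀` lists the eigenvalues in decreasing order, with multiplicities. -/
def WeakLogMajorized {d : ℕ} (X Y : Matrix (Fin d) (Fin d) ℂ) : Prop :=
  ∃ (hX : X.PosSemidef) (hY : Y.PosSemidef),
    ∀ k : ℕ, 1 ≤ k → k ≤ d →
      ∏ j : Fin (Fintype.card (Fin d)) with j.val < k, hX.isHermitian.eigenvalues₀ j ≤
        ∏ j : Fin (Fintype.card (Fin d)) with j.val < k, hY.isHermitian.eigenvalues₀ j

open Matrix

/-! Diagonalize B = ∑ bᵢ Pᵢ and put Eᵢ = Φ(Pᵢ), a positive resolution of the identity; positivity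
and unitality of Φ are needed only for this. Unless h vanishes, let aᵢ = h(bᵢ) and rᵢ = bᵢ / h(bᵢ).
Then X = ∑ aE, Y = ∑ raE and Z = ∑ ra²E are Φ(A), Φ(B) and Φ(AB); let R = ∑ rE.

The block matrix [R, Y; Y, Z] is positive, hence so is [XRX, XY; YX, Z]. A determinantal
Cauchy-Schwarz inequality on k-dimensional compressions bounds the squared product of the top k
singular values of XY by the products of the top k eigenvalues of XRX and of Z.

It remains to see λⱼ(XRX) ≤ λⱼ(Z) (`eigenvalues₀_conj_weightedSum_le`). This follows by
Courant-Fischer, comparing x with f = Xx: Kadison's inequality controls Xf, and Chebyshev's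
inequality applies to r and a², since concavity makes h(t) and t / h(t) both non-decreasing. -/

/-- The real part of the quadratic form `x ↦ x* M x`. -/
noncomputable def quadForm {n : Type*} [Fintype n] (M : Matrix n n ℂ) (x : n → ℂ) : ℝ :=
  (star x ⬝ᵥ M *ᵥ x).re

/-! ### Quadratic forms -/

section QuadForm

variable {m n : Type*} [Fintype m] [Fintype n]

lemma quadForm_conj (M : Matrix n n ℂ) (T : Matrix n m ℂ) (x : m → ℂ) :
    quadForm (Tᴴ * M * T) x = quadForm M (T *ᵥ x) := by
  simp only [quadForm, star_mulVec, ← mulVec_mulVec, dotProduct_mulVec, vecMul_vecMul]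

lemma quadForm_conj' (M : Matrix n n ℂ) (T : Matrix m n ℂ) (x : m → ℂ) :
    quadForm (T * M * Tᴴ) x = quadForm M (Tᴴ *ᵥ x) := by
  simpa using quadForm_conj M Tᴴ x

lemma quadForm_diagonal [DecidableEq n] (a : n → ℝ) (x : n → ℂ) :
    quadForm (diagonal (fun i => (a i : ℂ))) x = ∑ i, a i * ‖x i‖ ^ 2 := by
  simp only [quadForm, dotProduct, mulVec_diagonal, Pi.star_apply, Complex.re_sum]
  refine Finset.sum_congr rfl fun i _ => ?_
  rw [mul_left_comm, RCLike.star_def, Complex.conj_mul']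
  norm_cast

lemma quadForm_one [DecidableEq n] (x : n → ℂ) : quadForm 1 x = ∑ i, ‖x i‖ ^ 2 := by
  simpa [← diagonal_one] using quadForm_diagonal (fun _ : n => (1 : ℝ)) x

lemma quadForm_one_pos [DecidableEq n] {x : n → ℂ} (hx : x ≠ 0) : 0 < quadForm 1 x := by
  obtain ⟨i, hi⟩ := Function.ne_iff.mp hx
  rw [quadForm_one]
  exact Finset.sum_pos' (fun _ _ => by positivity)
    ⟨i, Finset.mem_univ _, by have : 0 < ‖x i‖ := norm_pos_iff.2 hi
                              positivity⟩

lemma quadForm_isometry [DecidableEq m] [DecidableEq n] {T : Matrix n m ℂ} (hT : Tᴴ * T = 1)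
    (x : m → ℂ) : quadForm 1 (T *ᵥ x) = quadForm 1 x := by
  rw [← quadForm_conj, Matrix.mul_one, hT]

lemma quadForm_nonneg {M : Matrix n n ℂ} (hM : M.PosSemidef) (x : n → ℂ) : 0 ≤ quadForm M x :=
  hM.re_dotProduct_nonneg x

lemma quadForm_sum {ι : Type*} (s : Finset ι) (M : ι → Matrix n n ℂ) (x : n → ℂ) :
    quadForm (∑ i ∈ s, M i) x = ∑ i ∈ s, quadForm (M i) x := by
  simp [quadForm, sum_mulVec, dotProduct_sum]

lemma quadForm_smul (c : ℝ) (M : Matrix n n ℂ) (x : n → ℂ) :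
    quadForm ((c : ℂ) • M) x = c * quadForm M x := by
  simp [quadForm, smul_mulVec]

lemma quadForm_sub (M N : Matrix n n ℂ) (x : n → ℂ) :
    quadForm (M - N) x = quadForm M x - quadForm N x := by
  simp [quadForm, sub_mulVec]

end QuadForm

/-! ### Eigenvalue comparison and determinant inequalities -/

section Eigenvalues

variable {m n : Type*} [Fintype m] [Fintype n] [DecidableEq m] [DecidableEq n]

/-- A Hermitian matrix is diagonalized by a square isometry so that the eigenvalues appear
in decreasing order. -/
lemma Matrix.IsHermitian.exists_sorted_diagonalization {H : Matrix n n ℂ} (hH : H.IsHermitian) :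
    ∃ V : Matrix n (Fin (Fintype.card n)) ℂ, Vᴴ * V = 1 ∧ V * Vᴴ = 1 ∧
      H = V * diagonal (fun i => (hH.eigenvalues₀ i : ℂ)) * Vᴴ := by
  set e : Fin (Fintype.card n) ≃ n := Fintype.equivOfCardEq (Fintype.card_fin _) with he
  let W : Matrix n n ℂ := hH.eigenvectorUnitary.1
  have h1 : Wᴴ * W = 1 := Unitary.coe_star_mul_self hH.eigenvectorUnitary
  have h2 : W * Wᴴ = 1 := Unitary.coe_mul_star_self hH.eigenvectorUnitary
  have h3 : H = W * diagonal (fun i => (hH.eigenvalues i : ℂ)) * Wᴴ := by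
    conv_lhs => rw [hH.spectral_theorem, Unitary.conjStarAlgAut_apply]
    rfl
  have hd : diagonal (fun i => (hH.eigenvalues₀ i : ℂ)) =
      (diagonal (fun i => (hH.eigenvalues i : ℂ))).submatrix e e := by
    rw [submatrix_diagonal_equiv]
    congr 1
    ext i
    simp [IsHermitian.eigenvalues, he]
  refine ⟨W.submatrix id e, ?_, ?_, ?_⟩
  · rw [conjTranspose_submatrix, submatrix_mul _ _ _ id _ Function.bijective_id |>.symm, h1,
      submatrix_one_equiv]
  · rw [conjTranspose_submatrix, submatrix_mul_equiv, h2, submatrix_id_id]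
  · rw [hd, conjTranspose_submatrix, submatrix_mul_equiv, submatrix_mul_equiv, ← h3,
      submatrix_id_id]

/-- Comparison of eigenvalues in the style of the Courant-Fischer principle. -/
theorem Matrix.IsHermitian.eigenvalues₀_le_of_quadForm {H : Matrix m m ℂ} {K : Matrix n n ℂ}
    (hH : H.IsHermitian) (hK : K.IsHermitian) (T : Matrix n m ℂ)
    {i : Fin (Fintype.card m)} {j : Fin (Fintype.card n)} (hij : j.val ≤ i.val)
    (h : ∀ x, x ≠ 0 → hH.eigenvalues₀ i * quadForm 1 x ≤ quadForm H x →
      T *ᵥ x ≠ 0 ∧ hH.eigenvalues₀ i * quadForm 1 (T *ᵥ x) ≤ quadForm K (T *ᵥ x)) :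
    hH.eigenvalues₀ i ≤ hK.eigenvalues₀ j := by
  obtain ⟨V, hV1, hV2, hV⟩ := hH.exists_sorted_diagonalization
  obtain ⟨W, hW1, hW2, hW⟩ := hK.exists_sorted_diagonalization
  let ι : Fin (i.val + 1) → Fin (Fintype.card m) := Fin.castLE i.isLt
  let κ : Fin j.val → Fin (Fintype.card n) := Fin.castLE j.isLt.le
  -- S has j rows and i + 1 > j columns. A kernel vector gives x in the span of the top i + 1
  -- eigenvectors of H with T x orthogonal to the first j eigenvectors of K.
  let S : Matrix (Fin j.val) (Fin (i.val + 1)) ℂ := (Wᴴ * T * V).submatrix κ ι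
  obtain ⟨c, hcS, hc⟩ := (Submodule.ne_bot_iff _).1
    (S.mulVecLin.ker_ne_bot_of_finrank_lt (by simp; omega))
  replace hcS : S *ᵥ c = 0 := hcS
  have hι : Function.Injective ι := Fin.castLE_injective _
  let b : Fin (Fintype.card m) → ℂ := Function.extend ι c 0
  have hbι : ∀ l, b (ι l) = c l := fun l => hι.extend_apply _ _ _
  have hb0 : ∀ l, i < l → b l = 0 := by
    intro l hl
    refine Function.extend_apply' _ _ _ ?_
    rintro ⟨a, rfl⟩
    have : i.val < a.val := hl
    omega
  have hb : b ≠ 0 := by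
    rintro hb
    exact hc (funext fun l => by rw [← hbι, hb]; rfl)
  have hx : V *ᵥ b ≠ 0 := by
    intro h0
    apply hb
    rw [← one_mulVec b, ← hV1, ← mulVec_mulVec, h0, mulVec_zero]
  have hqH : hH.eigenvalues₀ i * quadForm 1 (V *ᵥ b) ≤ quadForm H (V *ᵥ b) := by
    have hVb : Vᴴ *ᵥ (V *ᵥ b) = b := by rw [mulVec_mulVec, hV1, one_mulVec]
    rw [quadForm_isometry hV1, quadForm_one]
    conv_rhs => rw [hV]
    rw [quadForm_conj', hVb, quadForm_diagonal, Finset.mul_sum]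
    refine Finset.sum_le_sum fun l _ => ?_
    rcases le_or_gt l i with hl | hl
    · gcongr
      exact hH.eigenvalues₀_antitone hl
    · simp [hb0 l hl]
  obtain ⟨hy, hyK⟩ := h _ hx hqH
  have hw : ∀ l, l < j → (Wᴴ *ᵥ (T *ᵥ (V *ᵥ b))) l = 0 := by
    intro l hl
    have := congrFun hcS ⟨l.val, hl⟩
    rw [mulVec_mulVec, mulVec_mulVec]
    rw [Pi.zero_apply] at this
    rw [← this]
    simp only [mulVec, dotProduct, S, submatrix_apply]
    refine (Fintype.sum_of_injective ι hι _ _ ?_ ?_).symm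
    · intro a ha
      rw [show b a = 0 from Function.extend_apply' _ _ _ (by simpa using ha), mul_zero]
    · intro a
      rw [hbι]
      rfl
  have hKy : quadForm K (T *ᵥ (V *ᵥ b)) ≤
      hK.eigenvalues₀ j * quadForm 1 (T *ᵥ (V *ᵥ b)) := by
    have h1 : (Wᴴ)ᴴ * Wᴴ = 1 := by rw [conjTranspose_conjTranspose, hW2]
    conv_lhs => rw [hW]
    rw [← quadForm_isometry h1, quadForm_one, quadForm_conj', quadForm_diagonal, Finset.mul_sum]
    refine Finset.sum_le_sum fun l _ => ?_
    rcases le_or_gt j l with hl | hl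
    · gcongr
      exact hK.eigenvalues₀_antitone hl
    · rw [hw l hl]; simp
  exact le_of_mul_le_mul_right (hyK.trans hKy) (quadForm_one_pos hy)

lemma Matrix.IsHermitian.det_re_eq_prod_eigenvalues₀ {H : Matrix n n ℂ} (hH : H.IsHermitian) :
    H.det.re = ∏ i, hH.eigenvalues₀ i := by
  rw [hH.det_eq_prod_eigenvalues]
  have : ∏ i, hH.eigenvalues₀ i = ∏ i, hH.eigenvalues i :=
    (Equiv.prod_comp (Fintype.equivOfCardEq (Fintype.card_fin _)).symm _).symm
  rw [this]
  norm_cast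

lemma Matrix.PosSemidef.eigenvalues₀_nonneg {H : Matrix n n ℂ} (hH : H.PosSemidef)
    (i : Fin (Fintype.card n)) : 0 ≤ hH.isHermitian.eigenvalues₀ i := by
  have := hH.eigenvalues_nonneg (Fintype.equivOfCardEq (Fintype.card_fin _) i)
  simpa [IsHermitian.eigenvalues] using this

lemma Matrix.PosSemidef.det_re_nonneg {H : Matrix n n ℂ} (hH : H.PosSemidef) : 0 ≤ H.det.re :=
  (Complex.le_def.1 hH.det_nonneg).1

/-- The determinant is monotone for the Loewner order on positive semidefinite matrices. -/
lemma Matrix.PosSemidef.det_re_le_det_re {P Q : Matrix n n ℂ} (hP : P.PosSemidef)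
    (hQ : Q.PosSemidef) (h : (Q - P).PosSemidef) : P.det.re ≤ Q.det.re := by
  rw [hP.isHermitian.det_re_eq_prod_eigenvalues₀, hQ.isHermitian.det_re_eq_prod_eigenvalues₀]
  refine Finset.prod_le_prod (fun i _ => hP.eigenvalues₀_nonneg i) fun i _ =>
    hP.isHermitian.eigenvalues₀_le_of_quadForm hQ.isHermitian 1 le_rfl fun x hx hxP => ?_
  have := quadForm_nonneg h x
  rw [quadForm_sub] at this
  rw [one_mulVec]
  exact ⟨hx, by linarith⟩

/-- Compression to a `k`-dimensional subspace: the determinant is at most the product of the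
`k` largest eigenvalues. -/
lemma Matrix.PosSemidef.det_re_compression_le {K : Matrix n n ℂ} (hK : K.PosSemidef)
    {k : ℕ} (hk : k ≤ Fintype.card n) {U : Matrix n (Fin k) ℂ} (hU : Uᴴ * U = 1) :
    (Uᴴ * K * U).det.re ≤ ∏ j : Fin k, hK.isHermitian.eigenvalues₀ (Fin.castLE hk j) := by
  have hH := hK.conjTranspose_mul_mul_same U
  have hc : Fintype.card (Fin k) = k := Fintype.card_fin k
  rw [hH.isHermitian.det_re_eq_prod_eigenvalues₀, ← Equiv.prod_comp (finCongr hc.symm)]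
  refine Finset.prod_le_prod (fun i _ => hH.eigenvalues₀_nonneg _) fun i _ =>
    hH.isHermitian.eigenvalues₀_le_of_quadForm hK.isHermitian U (by simp) fun x hx hxP => ?_
  rw [quadForm_isometry hU, ← quadForm_conj]
  refine ⟨fun h0 => hx ?_, hxP⟩
  rw [← one_mulVec x, ← hU, ← mulVec_mulVec, h0, mulVec_zero]

/-- The determinantal Cauchy-Schwarz inequality for positive semidefinite block matrices. -/
theorem Matrix.norm_det_sq_le_of_fromBlocks_posSemidef {P W Q : Matrix n n ℂ}
    (h : (fromBlocks P W Wᴴ Q).PosSemidef) : ‖W.det‖ ^ 2 ≤ P.det.re * Q.det.re := by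
  have hP : P.PosSemidef := h.submatrix Sum.inl
  have hQ : Q.PosSemidef := h.submatrix Sum.inr
  -- For singular P there is no Schur complement, but a null vector v of P makes (v, 0) a null
  -- vector of the block matrix, which forces det W = 0.
  by_cases hdet : P.det = 0
  · obtain ⟨v, hv, hPv⟩ := exists_mulVec_eq_zero_iff.2 hdet
    have hker : fromBlocks P W Wᴴ Q *ᵥ Sum.elim v 0 = 0 := by
      rw [← h.dotProduct_mulVec_zero_iff, fromBlocks_mulVec]
      simp [dotProduct, hPv]
    have hWv : Wᴴ *ᵥ v = 0 := by
      have := congrArg (fun f => f ∘ Sum.inr) hker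
      rw [fromBlocks_mulVec] at this
      simpa [Sum.elim_comp_inl] using this
    have : Wᴴ.det = 0 := exists_mulVec_eq_zero_iff.1 ⟨v, hv, hWv⟩
    rw [det_conjTranspose, star_eq_zero] at this
    simp [this, hdet]
  · have hPD : P.PosDef := hP.posDef_iff_det_ne_zero.2 hdet
    have : Invertible P := hPD.isUnit.invertible
    -- The Schur complement gives Wᴴ P⁻¹ W ≤ Q; take determinants.
    have hS := (PosDef.fromBlocks₁₁ W Q hPD).1 h
    have hle := (hP.inv.conjTranspose_mul_mul_same W).det_re_le_det_re hQ hS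
    have hPre : 0 < P.det.re := (Complex.lt_def.1 hPD.det_pos).1
    have hPim : P.det = (P.det.re : ℂ) := by
      apply Complex.ext
      · simp
      · simpa using ((Complex.lt_def.1 hPD.det_pos).2).symm
    have : (Wᴴ * P⁻¹ * W).det.re = ‖W.det‖ ^ 2 / P.det.re := by
      rw [det_mul, det_mul, det_conjTranspose, det_nonsing_inv, Ring.inverse_eq_inv',
        mul_right_comm, RCLike.star_def, Complex.conj_mul', hPim, Complex.ofReal_re, ← Complex.ofReal_pow,
        ← Complex.ofReal_inv, ← Complex.ofReal_mul, Complex.ofReal_re, div_eq_mul_inv]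
    rw [this, div_le_iff₀ hPre] at hle
    linarith

end Eigenvalues

/-- Weighted Chebyshev inequality. -/
lemma sum_mul_sum_le_of_monovary {ι : Type*} [Fintype ι] {p f g : ι → ℝ} (hp : ∀ i, 0 ≤ p i)
    (h : ∀ i j, 0 ≤ (f i - f j) * (g i - g j)) :
    (∑ i, f i * p i) * (∑ i, g i * p i) ≤ (∑ i, f i * g i * p i) * ∑ i, p i := by
  have h1 : 0 ≤ ∑ i, ∑ j, p i * p j * ((f i - f j) * (g i - g j)) :=
    Finset.sum_nonneg fun i _ => Finset.sum_nonneg fun j _ =>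
      mul_nonneg (mul_nonneg (hp i) (hp j)) (h i j)
  have h2 : ∑ i, ∑ j, p i * p j * ((f i - f j) * (g i - g j)) =
      2 * ((∑ i, f i * g i * p i) * ∑ i, p i) - 2 * ((∑ i, f i * p i) * (∑ i, g i * p i)) := by
    have e (u v : ι → ℝ) : ∑ i, ∑ j, u i * v j = (∑ i, u i) * ∑ j, v j :=
      (Finset.sum_mul_sum _ _ _ _).symm
    calc _ = ∑ i, ∑ j, (((f i * g i * p i) * p j + p i * (f j * g j * p j))
            - ((f i * p i) * (g j * p j) + (g i * p i) * (f j * p j))) := by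
          refine Finset.sum_congr rfl fun i _ => Finset.sum_congr rfl fun j _ => by ring
      _ = _ := by
          simp only [Finset.sum_sub_distrib, Finset.sum_add_distrib, e]
          ring
  linarith

/-! ### Combinations of a positive resolution of the identity -/

section WeightedSum

variable {ι n : Type*} [Fintype ι]

/-- The linear combination `∑ i, c i • E i` of matrices with real coefficients. -/
noncomputable def weightedSum (E : ι → Matrix n n ℂ) (c : ι → ℝ) : Matrix n n ℂ :=
  ∑ i, (c i : ℂ) • E i

variable {E : ι → Matrix n n ℂ}

lemma quadForm_weightedSum [Fintype n] (c : ι → ℝ) (x : n → ℂ) :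
    quadForm (weightedSum E c) x = ∑ i, c i * quadForm (E i) x := by
  simp only [weightedSum, quadForm_sum, quadForm_smul]

lemma weightedSum_posSemidef (hE : ∀ i, (E i).PosSemidef) {c : ι → ℝ} (hc : ∀ i, 0 ≤ c i) :
    (weightedSum E c).PosSemidef :=
  posSemidef_sum _ fun i _ => (hE i).smul (by exact_mod_cast hc i)

variable [Fintype n] [DecidableEq n]

/-- Each summand is r Lᴴ E L, where L is the block row (1, a·1). -/
lemma fromBlocks_weightedSum_posSemidef (hE : ∀ i, (E i).PosSemidef) (a : ι → ℝ) {r : ι → ℝ}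
    (hr : ∀ i, 0 ≤ r i) :
    (fromBlocks (weightedSum E r) (weightedSum E fun i => r i * a i)
      (weightedSum E fun i => r i * a i)ᴴ (weightedSum E fun i => r i * a i ^ 2)).PosSemidef := by
  have hY : (weightedSum E fun i => r i * a i)ᴴ = weightedSum E fun i => r i * a i := by
    simp only [weightedSum, conjTranspose_sum, conjTranspose_smul]
    exact Finset.sum_congr rfl fun i _ => by rw [(hE i).isHermitian.eq]; simp
  let L (i : ι) : Matrix n (n ⊕ n) ℂ := fromCols 1 ((a i : ℂ) • (1 : Matrix n n ℂ))
  have key : ∑ i, (r i : ℂ) • ((L i)ᴴ * E i * L i) =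
      fromBlocks (weightedSum E r) (weightedSum E fun i => r i * a i)
      (weightedSum E fun i => r i * a i)ᴴ (weightedSum E fun i => r i * a i ^ 2) := by
    rw [hY]
    have hL (i : ι) : (L i)ᴴ * E i * L i =
        fromBlocks (E i) ((a i : ℂ) • E i) ((a i : ℂ) • E i) ((a i : ℂ) ^ 2 • E i) := by
      simp only [L, conjTranspose_fromCols_eq_fromRows_conjTranspose, fromRows_mul,
        mul_fromCols, conjTranspose_one, conjTranspose_smul, RCLike.star_def,
        Complex.conj_ofReal, Matrix.one_mul, Matrix.mul_one, Matrix.smul_mul, Matrix.mul_smul, sq]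
      ext (i | i) (j | j) <;> simp [mul_assoc]
    simp only [hL]
    ext (i | i) (j | j) <;> simp [Matrix.sum_apply, weightedSum, mul_assoc, -Complex.coe_smul]
  rw [← key]
  exact posSemidef_sum _ fun i _ =>
    ((hE i).conjTranspose_mul_mul_same (L i)).smul (by exact_mod_cast hr i)

/-- Kadison's inequality for a resolution of the identity. -/
lemma quadForm_one_weightedSum_mulVec_le (hE : ∀ i, (E i).PosSemidef) (hE1 : ∑ i, E i = 1)
    (a : ι → ℝ) (x : n → ℂ) :
    quadForm 1 (weightedSum E a *ᵥ x) ≤ quadForm (weightedSum E fun i => a i ^ 2) x := by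
  have h := fromBlocks_weightedSum_posSemidef hE a (r := fun _ => 1) (fun _ => zero_le_one)
  have h1 : weightedSum E (fun _ => 1) = 1 := by simp [weightedSum, hE1]
  simp only [one_mul, h1] at h
  have : Invertible (1 : Matrix n n ℂ) := invertibleOne
  have h2 := quadForm_nonneg ((PosDef.fromBlocks₁₁ _ _ PosDef.one).1 h) x
  rw [quadForm_sub, inv_one, quadForm_conj] at h2
  linarith

/-- With `X = ∑ a E`, `R = ∑ r E`, `Z = ∑ r a² E`, the eigenvalues of `X R X` are dominated by
those of `Z` as soon as `a` and `r` vary in the same direction. -/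
theorem eigenvalues₀_conj_weightedSum_le (hE : ∀ i, (E i).PosSemidef) (hE1 : ∑ i, E i = 1)
    {a r : ι → ℝ} (ha : ∀ i, 0 ≤ a i) (har : ∀ i j, 0 ≤ (r i - r j) * (a i - a j))
    (hH : ((weightedSum E a)ᴴ * weightedSum E r * weightedSum E a).PosSemidef)
    (hZ : (weightedSum E fun i => r i * a i ^ 2).PosSemidef) (j : Fin (Fintype.card n)) :
    hH.isHermitian.eigenvalues₀ j ≤ hZ.isHermitian.eigenvalues₀ j := by
  set X := weightedSum E a
  have hX : X.PosSemidef := weightedSum_posSemidef hE ha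
  -- A positive eigenvalue is what guarantees X x ≠ 0 below.
  rcases (hH.eigenvalues₀_nonneg j).eq_or_lt with h0 | hpos
  · rw [← h0]; exact hZ.eigenvalues₀_nonneg j
  refine hH.isHermitian.eigenvalues₀_le_of_quadForm hZ.isHermitian X le_rfl fun x hx hxH => ?_
  set μ := hH.isHermitian.eigenvalues₀ j
  rw [quadForm_conj] at hxH
  have hx1 := quadForm_one_pos hx
  have hf : X *ᵥ x ≠ 0 := by
    intro h
    rw [h] at hxH
    have : quadForm (weightedSum E r) 0 = 0 := by simp [quadForm]
    rw [this] at hxH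
    exact absurd hxH (not_le.2 (mul_pos hpos hx1))
  refine ⟨hf, ?_⟩
  set f := X *ᵥ x with hfdef
  have hf1 := quadForm_one_pos hf
  -- Chebyshev with weights ⟨f, Eᵢ f⟩; as a ≥ 0, a² is ordered like a.
  have hcheb : quadForm (weightedSum E r) f * quadForm (weightedSum E fun i => a i ^ 2) f ≤
      quadForm (weightedSum E fun i => r i * a i ^ 2) f * quadForm 1 f := by
    rw [← hE1, quadForm_sum]
    simp only [quadForm_weightedSum]
    refine sum_mul_sum_le_of_monovary (fun i => quadForm_nonneg (hE i) f) fun i j => ?_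
    have := mul_nonneg (har i j) (add_nonneg (ha i) (ha j))
    nlinarith
  have hkad := quadForm_one_weightedSum_mulVec_le hE hE1 a f
  -- Cauchy-Schwarz for `⟨f, f⟩ = ⟨x, X f⟩`
  have hcs : quadForm 1 f ^ 2 ≤ quadForm 1 x * quadForm 1 (X *ᵥ f) := by
    have e : quadForm 1 f = (star x ⬝ᵥ (X *ᵥ f)).re := by
      rw [hfdef, ← quadForm_conj, quadForm, hX.isHermitian.eq, Matrix.mul_one, ← mulVec_mulVec]
    have hn (v : n → ℂ) : quadForm 1 v = ‖WithLp.toLp 2 v‖ ^ 2 := by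
      rw [quadForm_one, EuclideanSpace.norm_sq_eq]
    have hi : star x ⬝ᵥ (X *ᵥ f) = inner ℂ (WithLp.toLp 2 x) (WithLp.toLp 2 (X *ᵥ f)) := by
      rw [EuclideanSpace.inner_eq_star_dotProduct, dotProduct_comm]
    have hle : |quadForm 1 f| ≤ ‖WithLp.toLp 2 x‖ * ‖WithLp.toLp 2 (X *ᵥ f)‖ := by
      rw [e, hi]
      exact (Complex.abs_re_le_norm _).trans (norm_inner_le_norm _ _)
    rw [hn x, hn (X *ᵥ f), ← mul_pow, ← sq_abs]
    gcongr
  have hA2 : quadForm 1 f ^ 2 ≤ quadForm 1 x * quadForm (weightedSum E fun i => a i ^ 2) f :=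
    hcs.trans (by gcongr)
  have hA2' : 0 ≤ quadForm (weightedSum E fun i => a i ^ 2) f :=
    quadForm_nonneg (weightedSum_posSemidef hE fun i => sq_nonneg _) f
  have : μ * quadForm 1 f * quadForm 1 f ≤
      quadForm (weightedSum E fun i => r i * a i ^ 2) f * quadForm 1 f := by
    calc μ * quadForm 1 f * quadForm 1 f = μ * quadForm 1 f ^ 2 := by ring
      _ ≤ μ * (quadForm 1 x * quadForm (weightedSum E fun i => a i ^ 2) f) := by gcongr
      _ = (μ * quadForm 1 x) * quadForm (weightedSum E fun i => a i ^ 2) f := by ring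
      _ ≤ quadForm (weightedSum E r) f * quadForm (weightedSum E fun i => a i ^ 2) f := by gcongr
      _ ≤ _ := hcheb
  exact le_of_mul_le_mul_right this hf1

/-- The product of the `k` largest eigenvalues of `|M|`, when positive, is a `k`-dimensional
minor of `M`. -/
lemma exists_isometries_det_eq_prod_eigenvalues₀_abs {M N : Matrix n n ℂ} (hN : N.PosSemidef)
    (hNM : N * N = Mᴴ * M) {k : ℕ} (hk : k ≤ Fintype.card n)
    (hpos : ∀ j : Fin k, 0 < hN.isHermitian.eigenvalues₀ (Fin.castLE hk j)) :
    ∃ U V : Matrix n (Fin k) ℂ, Uᴴ * U = 1 ∧ Vᴴ * V = 1 ∧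
      (Uᴴ * M * V).det = ∏ j : Fin k, (hN.isHermitian.eigenvalues₀ (Fin.castLE hk j) : ℂ) := by
  obtain ⟨W, hW1, hW2, hW⟩ := hN.isHermitian.exists_sorted_diagonalization
  set ν := hN.isHermitian.eigenvalues₀
  let ι : Fin k → Fin (Fintype.card n) := Fin.castLE hk
  have hι : Function.Injective ι := Fin.castLE_injective _
  let V : Matrix n (Fin k) ℂ := W.submatrix id ι
  let D : Matrix (Fin k) (Fin k) ℂ := diagonal fun j => (ν (ι j) : ℂ)
  let D' : Matrix (Fin k) (Fin k) ℂ := diagonal fun j => ((ν (ι j))⁻¹ : ℂ)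
  have hV : Vᴴ * V = 1 := by
    rw [show Vᴴ * V = (Wᴴ * W).submatrix ι ι from rfl, hW1, submatrix_one _ hι]
  have hDD' : D' * D = 1 := by
    rw [diagonal_mul_diagonal, ← diagonal_one]
    congr 1
    ext j
    exact inv_mul_cancel₀ (by exact_mod_cast (hpos j).ne')
  have hD'H : D'ᴴ = D' := by
    rw [diagonal_conjTranspose]
    congr 1
    ext j
    simp
  have hMM : Vᴴ * (Mᴴ * M) * V = D * D := by
    have : Wᴴ * (Mᴴ * M) * W = diagonal (fun i => (ν i : ℂ)) * diagonal (fun i => (ν i : ℂ)) := by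
      rw [← hNM, hW]
      simp only [Matrix.mul_assoc, hW1, Matrix.mul_one]
      simp only [← Matrix.mul_assoc, hW1, Matrix.one_mul]
    have h2 : Vᴴ * (Mᴴ * M) * V = (Wᴴ * (Mᴴ * M) * W).submatrix ι ι := rfl
    rw [h2, this, diagonal_mul_diagonal, diagonal_mul_diagonal, submatrix_diagonal _ _ hι]
    rfl
  -- The columns of V are the top right singular vectors of M; those of M V D⁻¹ are the matching
  -- left ones.
  refine ⟨M * V * D', V, ?_, hV, ?_⟩
  · calc (M * V * D')ᴴ * (M * V * D') = D' * (Vᴴ * (Mᴴ * M) * V) * D' := by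
          simp only [conjTranspose_mul, hD'H, Matrix.mul_assoc]
      _ = (D' * D) * (D' * D)ᴴ := by
          have hDH : Dᴴ = D := by
            rw [diagonal_conjTranspose]
            congr 1
            ext j
            simp
          rw [hMM, conjTranspose_mul, hD'H, hDH]
          simp only [Matrix.mul_assoc]
      _ = 1 := by rw [hDD']; simp
  · have : (M * V * D')ᴴ * M * V = D' * (Vᴴ * (Mᴴ * M) * V) := by
      simp only [conjTranspose_mul, hD'H, Matrix.mul_assoc]
    rw [this, hMM, ← Matrix.mul_assoc, hDD', Matrix.one_mul, det_diagonal]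

/-- Weak log-majorization for the product of two positive combinations of a resolution of the
identity. -/
theorem prod_eigenvalues₀_abs_weightedSum_mul_le (hE : ∀ i, (E i).PosSemidef)
    (hE1 : ∑ i, E i = 1) {a r : ι → ℝ} (ha : ∀ i, 0 ≤ a i) (hr : ∀ i, 0 ≤ r i)
    (har : ∀ i j, 0 ≤ (r i - r j) * (a i - a j)) {N : Matrix n n ℂ} (hN : N.PosSemidef)
    (hNM : N * N = (weightedSum E a * weightedSum E fun i => r i * a i)ᴴ *
      (weightedSum E a * weightedSum E fun i => r i * a i))
    (hZ : (weightedSum E fun i => r i * a i ^ 2).PosSemidef) {k : ℕ} (hk : k ≤ Fintype.card n) :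
    ∏ j : Fin k, hN.isHermitian.eigenvalues₀ (Fin.castLE hk j) ≤
      ∏ j : Fin k, hZ.isHermitian.eigenvalues₀ (Fin.castLE hk j) := by
  have hZ0 : 0 ≤ ∏ j : Fin k, hZ.isHermitian.eigenvalues₀ (Fin.castLE hk j) :=
    Finset.prod_nonneg fun j _ => hZ.eigenvalues₀_nonneg _
  by_cases hpos : ∀ j : Fin k, 0 < hN.isHermitian.eigenvalues₀ (Fin.castLE hk j)
  swap
  · push Not at hpos
    obtain ⟨j, hj⟩ := hpos
    rwa [Finset.prod_eq_zero (Finset.mem_univ j) (hj.antisymm (hN.eigenvalues₀_nonneg _))]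
  obtain ⟨U, V, hU, hV, hdet⟩ := exists_isometries_det_eq_prod_eigenvalues₀_abs hN hNM hk hpos
  set X := weightedSum E a
  set R := weightedSum E r
  set Y := weightedSum E fun i => r i * a i
  set Z := weightedSum E fun i => r i * a i ^ 2
  have hX : Xᴴ = X := (weightedSum_posSemidef hE ha).isHermitian.eq
  have hH : (Xᴴ * R * X).PosSemidef := (weightedSum_posSemidef hE hr).conjTranspose_mul_mul_same X
  have hblock : (fromBlocks (Uᴴ * (Xᴴ * R * X) * U) (Uᴴ * (X * Y) * V) (Uᴴ * (X * Y) * V)ᴴ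
      (Vᴴ * Z * V)).PosSemidef := by
    have hRYZ : (fromBlocks R Y Yᴴ Z).PosSemidef := fromBlocks_weightedSum_posSemidef hE a hr
    -- Conjugation by diag(XU, V) both turns R into XRX and compresses.
    convert hRYZ.conjTranspose_mul_mul_same (fromBlocks (X * U) 0 0 V) using 1
    clear_value X R Y Z
    simp only [conjTranspose_conjTranspose, fromBlocks_conjTranspose, fromBlocks_multiply, conjTranspose_mul, hX,
      conjTranspose_zero, Matrix.zero_mul, Matrix.mul_zero, add_zero, zero_add, Matrix.mul_assoc]
  have h1 := norm_det_sq_le_of_fromBlocks_posSemidef hblock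
  have h2 := hH.det_re_compression_le hk hU
  have h3 := hZ.det_re_compression_le hk hV
  have h4 : ∏ j : Fin k, hH.isHermitian.eigenvalues₀ (Fin.castLE hk j) ≤
      ∏ j : Fin k, hZ.isHermitian.eigenvalues₀ (Fin.castLE hk j) :=
    Finset.prod_le_prod (fun j _ => hH.eigenvalues₀_nonneg _) fun j _ =>
      eigenvalues₀_conj_weightedSum_le hE hE1 ha har hH hZ _
  have h5 : ‖(Uᴴ * (X * Y) * V).det‖ =
      ∏ j : Fin k, hN.isHermitian.eigenvalues₀ (Fin.castLE hk j) := by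
    rw [hdet, ← Complex.ofReal_prod, Complex.norm_real, Real.norm_eq_abs,
      abs_of_nonneg (Finset.prod_nonneg fun j _ => hN.eigenvalues₀_nonneg _)]
  rw [h5] at h1
  refine le_of_sq_le_sq (h1.trans ?_) hZ0
  rw [sq]
  exact mul_le_mul (h2.trans h4) h3 (hZ.conjTranspose_mul_mul_same V).det_re_nonneg hZ0

end WeightedSum

/-! ### Non-negative concave functions on the half-line -/

section ConcaveFunctions

variable {h : ℝ → ℝ}

/-- After one drop, concavity keeps the slope at least as negative, so h would eventually be
negative. -/
lemma ConcaveOn.monotoneOn_Ici_of_nonneg (hc : ConcaveOn ℝ (Set.Ici 0) h)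
    (h0 : ∀ t, 0 ≤ t → 0 ≤ h t) : MonotoneOn h (Set.Ici 0) := by
  intro s hs t ht hst
  rcases hst.eq_or_lt with rfl | hst
  · exact le_rfl
  by_contra! hlt
  have hs0 : 0 ≤ s := hs
  have hδ : 0 < h s - h t := sub_pos.2 hlt
  -- Chosen so that (M - t)(h s - h t) exceeds t h(s) ≥ (t - s) h(t), which puts the chord through s
  -- and t below zero at M.
  obtain ⟨M, hM⟩ : ∃ M, M = t * h s / (h s - h t) + t + 1 := ⟨_, rfl⟩
  have hfrac : 0 ≤ t * h s / (h s - h t) :=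
    div_nonneg (mul_nonneg (hs0.trans hst.le) (h0 s hs0)) hδ.le
  have hMt : t < M := by linarith
  have hslope := hc.slope_anti_adjacent hs (show (0 : ℝ) ≤ M by linarith) hst hMt
  have hM0 := h0 M (by linarith)
  rw [div_le_div_iff₀ (by linarith) (by linarith)] at hslope
  have hMδ : M * (h s - h t) = t * h s + (t + 1) * (h s - h t) := by
    rw [hM]
    field_simp
    ring
  nlinarith [mul_nonneg hM0 (sub_nonneg.2 hst.le), h0 t (hs0.trans hst.le),
    mul_nonneg hs0 (h0 t (hs0.trans hst.le)), mul_nonneg (hs0.trans hst.le) hδ.le]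

/-- This is monotonicity of h(t) / t without division: s is a convex combination of 0 and t, and
h(0) ≥ 0. -/
lemma ConcaveOn.mul_le_mul_of_nonneg (hc : ConcaveOn ℝ (Set.Ici 0) h) (h0 : 0 ≤ h 0)
    {s t : ℝ} (hs : 0 ≤ s) (hst : s ≤ t) : s * h t ≤ t * h s := by
  rcases (hs.trans hst).eq_or_lt with ht | ht
  · obtain rfl : s = 0 := by linarith
    simp [← ht]
  have := hc.2 (show (0 : ℝ) ≤ 0 from le_rfl) (show (0 : ℝ) ≤ t from ht.le)
    (show 0 ≤ 1 - s / t by rw [sub_nonneg, div_le_one ht]; exact hst)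
    (show 0 ≤ s / t by positivity) (by ring)
  simp only [smul_eq_mul, mul_zero, zero_add, div_mul_cancel₀ _ ht.ne'] at this
  have h1 : 0 ≤ (1 - s / t) * h 0 :=
    mul_nonneg (by rw [sub_nonneg, div_le_one ht]; exact hst) h0
  have h2 : s / t * h t ≤ h s := by linarith
  calc s * h t = t * (s / t * h t) := by field_simp
    _ ≤ t * h s := by gcongr

/-- A zero at t > 0 spreads left because h is non-decreasing, and right because h(u) / u is
non-increasing. -/
lemma ConcaveOn.eq_zero_or_pos (hc : ConcaveOn ℝ (Set.Ici 0) h) (h0 : ∀ t, 0 ≤ t → 0 ≤ h t) :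
    (∀ t, 0 ≤ t → h t = 0) ∨ ∀ t, 0 < t → 0 < h t := by
  by_contra! hcon
  obtain ⟨⟨u, hu, hu0⟩, t, ht, ht0⟩ := hcon
  refine hu0 (le_antisymm ?_ (h0 u hu))
  rcases le_total u t with hut | hut
  · exact (hc.monotoneOn_Ici_of_nonneg h0 hu ht.le hut).trans ht0
  · have := hc.mul_le_mul_of_nonneg (h0 0 le_rfl) ht.le hut
    nlinarith

/-- If `h` is concave, then `h` and `t ↦ t / h t` vary in the same direction. -/
lemma ConcaveOn.div_sub_mul_sub_nonneg (hc : ConcaveOn ℝ (Set.Ici 0) h)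
    (h0 : ∀ t, 0 ≤ t → 0 ≤ h t) (hpos : ∀ t, 0 < t → 0 < h t) {s t : ℝ} (hs : 0 ≤ s)
    (ht : 0 ≤ t) : 0 ≤ (s / h s - t / h t) * (h s - h t) := by
  wlog hst : s ≤ t generalizing s t
  · have := this ht hs (le_of_not_ge hst)
    linarith
  refine mul_nonneg_of_nonpos_of_nonpos (sub_nonpos.2 ?_)
    (sub_nonpos.2 (hc.monotoneOn_Ici_of_nonneg h0 hs ht hst))
  rcases hs.eq_or_lt with rfl | hs'
  · simpa using div_nonneg ht (h0 t ht)
  · rw [div_le_div_iff₀ (hpos s hs') (hpos t (hs'.trans_le hst))]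
    exact hc.mul_le_mul_of_nonneg (h0 0 le_rfl) hs hst

end ConcaveFunctions

/-! ### Spectral resolution and the main theorem -/

/-- Spectral resolution of the functional calculus of a Hermitian matrix. -/
lemma Matrix.IsHermitian.exists_spectral_resolution {n : Type*} [Fintype n] [DecidableEq n]
    {B : Matrix n n ℂ} (hB : B.IsHermitian) :
    ∃ P : n → Matrix n n ℂ, (∀ i, (P i).PosSemidef) ∧ ∑ i, P i = 1 ∧
      ∀ f : ℝ → ℝ, cfc f B = weightedSum P fun i => f (hB.eigenvalues i) := by
  let W : Matrix n n ℂ := hB.eigenvectorUnitary.1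
  have hW : W * Wᴴ = 1 := Unitary.coe_mul_star_self hB.eigenvectorUnitary
  have hsum (c : n → ℂ) : ∑ i, c i • (W * diagonal (Pi.single i 1) * Wᴴ) =
      W * diagonal c * Wᴴ := by
    have hc : diagonal c = ∑ i, c i • diagonal (Pi.single i (1 : ℂ)) := by
      ext i j
      rcases eq_or_ne i j with rfl | hij
      · simp [Matrix.sum_apply, Pi.single_apply]
      · simp [Matrix.sum_apply, diagonal_apply_ne _ hij]
    rw [hc, Matrix.mul_sum, Matrix.sum_mul]
    simp only [Matrix.mul_smul, Matrix.smul_mul]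
  refine ⟨fun i => W * diagonal (Pi.single i 1) * Wᴴ, fun i => ?_, ?_, fun f => ?_⟩
  · exact (PosSemidef.diagonal (Pi.single_nonneg.2 zero_le_one)).mul_mul_conjTranspose_same W
  · have := hsum 1
    simpa [hW] using this
  · rw [hB.cfc_eq, IsHermitian.cfc, Unitary.conjStarAlgAut_apply, weightedSum, hsum]
    rfl

lemma map_weightedSum {ι m n : Type*} [Fintype ι] [Fintype m] [Fintype n] [DecidableEq m]
    [DecidableEq n] (Φ : Matrix m m ℂ →ₚ[ℂ] Matrix n n ℂ) (P : ι → Matrix m m ℂ) (c : ι → ℝ) :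
    Φ (weightedSum P c) = weightedSum (fun i => Φ (P i)) c := by
  simp [weightedSum, map_sum]

lemma Fin.prod_filter_val_lt {M : Type*} [CommMonoid M] {N k : ℕ} (hk : k ≤ N) (f : Fin N → M) :
    ∏ j : Fin N with j.val < k, f j = ∏ j : Fin k, f (Fin.castLE hk j) := by
  refine (Finset.prod_bij (fun j _ => Fin.castLE hk j) (by simp) ?_ ?_ (by simp)).symm
  · intro a _ b _ hab
    exact Fin.castLE_injective hk hab
  · intro b hb
    exact ⟨⟨b.val, by simpa using hb⟩, Finset.mem_univ _, rfl⟩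

theorem corollary2p5 {n d : ℕ} (A B : Matrix (Fin n) (Fin n) ℂ)
    (hAB : IsConcaveMonotonePair A B)
    (Φ : Matrix (Fin n) (Fin n) ℂ →ₚ[ℂ] Matrix (Fin d) (Fin d) ℂ) (hΦ : Φ 1 = 1) :
    WeakLogMajorized (CFC.abs (Φ A * Φ B)) (Φ (A * B)) := by
  obtain ⟨⟨C, f, g, hC, -, -, -, hg0, -, hBg⟩, h, hconc, h0, hAh⟩ := hAB
  have hB : B.PosSemidef := by
    rw [← nonneg_iff_posSemidef, hBg]
    exact cfc_nonneg fun x hx => hg0 x (spectrum_nonneg_of_nonneg hC.nonneg hx)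
  obtain ⟨P, hP, hP1, hcfc⟩ := hB.isHermitian.exists_spectral_resolution
  set b := hB.isHermitian.eigenvalues
  have hb : ∀ i, 0 ≤ b i := hB.eigenvalues_nonneg
  have hBid : cfc (fun t : ℝ => t) B = B := cfc_id' ℝ B hB.isHermitian
  have hABcfc : A * B = cfc (fun t => h t * t) B := by
    have hcont (u : ℝ → ℝ) : ContinuousOn u (spectrum ℝ B) := B.finite_real_spectrum.continuousOn u
    rw [cfc_mul h (fun t => t) B (hcont _) (hcont _), hBid, hAh]
  rcases hconc.eq_zero_or_pos h0 with hz | hpos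
  · have hA : A = 0 := by
      rw [hAh, hcfc]
      simp [weightedSum, hz _ (hb _)]
    simp only [hA, map_zero, zero_mul, CFC.abs_zero]
    exact ⟨.zero, .zero, fun _ _ _ => le_rfl⟩
  let E (i : Fin n) : Matrix (Fin d) (Fin d) ℂ := Φ (P i)
  have hE (i : Fin n) : (E i).PosSemidef :=
    nonneg_iff_posSemidef.1 (Φ.map_nonneg (hP i).nonneg)
  have hE1 : ∑ i, E i = 1 := by rw [← hΦ, ← hP1, map_sum]
  let a (i : Fin n) : ℝ := h (b i)
  let r (i : Fin n) : ℝ := b i / h (b i)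
  have ha : ∀ i, 0 ≤ a i := fun i => h0 _ (hb i)
  -- If bᵢ = 0, then rᵢ = 0 even when h(0) = 0, by the convention 0 / 0 = 0.
  have hra (i : Fin n) : r i * a i = b i := by
    rcases (hb i).eq_or_lt with hi | hi
    · simp [r, ← hi]
    · exact div_mul_cancel₀ _ (hpos _ hi).ne'
  have hΦA : Φ A = weightedSum E a := by
    rw [hAh, hcfc, map_weightedSum]
  have hΦB : Φ B = weightedSum E fun i => r i * a i := by
    conv_lhs => rw [← hBid, hcfc, map_weightedSum]
    simp only [hra]
    rfl
  have hΦAB : Φ (A * B) = weightedSum E fun i => r i * a i ^ 2 := by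
    rw [hABcfc, hcfc, map_weightedSum]
    congr 1
    ext i
    rw [sq, ← mul_assoc, hra, mul_comm]
  have hr : ∀ i, 0 ≤ r i := fun i => div_nonneg (hb i) (ha i)
  have hZ := weightedSum_posSemidef hE fun i => mul_nonneg (hr i) (sq_nonneg (a i))
  have hN := nonneg_iff_posSemidef.1 (CFC.abs_nonneg (Φ A * Φ B))
  have hNM := CFC.abs_mul_abs (Φ A * Φ B)
  rw [hΦAB]
  rw [hΦA, hΦB] at hN hNM ⊢
  refine ⟨hN, hZ, fun k _ hk => ?_⟩
  rw [← Fintype.card_fin d] at hk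
  rw [Fin.prod_filter_val_lt hk, Fin.prod_filter_val_lt hk]
  exact prod_eigenvalues₀_abs_weightedSum_mul_le hE hE1 ha hr
    (fun i j => hconc.div_sub_mul_sub_nonneg h0 hpos (hb i) (hb j)) hN hNM hZ hk
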